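/- Let $\Omega=\{-1,1\}^{\mathbb Z^d}$ with the product topology and its Borel $\sigma$-field. For $i\in\mathbb Z^d$ let $\sigma^i$ be the configuration $\sigma$ with the spin at $i$ flipped and $\nabla_i f(\sigma)=f(\sigma^i)-f(\sigma)$; for finite $B\subset\mathbb Z^d$ let $\sigma_B=\prod_{i\in B}\sigma_i$ (so $\sigma_\emptyset=1$), and put $L_B=\sum_{i\in\mathbb Z^d}\sigma_{B+i}\nabla_i$ on local functions (functions depending on finitely many coordinates). Let $\mathcal B$ be a finite collection of finite subsets of $\mathbb Z^d$ and $\lambda:\mathcal B\to\mathbb R$ such that the flip rates $c(i,\sigma)=\sum_{B\in\mathcal B}\lambda(B)\,\sigma_{B+i}$ are nonnegative, and let $$\mathcal L_{\mathcal B}=\sum_{B\in\mathcal B}\lambda(B)L_B$$ be the corresponding translation-invariant finite-range spin-flip (pre-)generator on local functions. Let $(S(t))_{t\ge 0}$ be the Markov (Feller) semigroup on $C(\Omega)$ whose infinitesimal generator is the closure of $\mathcal L_{\mathcal B}$ in the supremum norm, and for a probability measure $\mu$ on $\Omega$ let $\mu S(t)$ be the probability measure determined by $\int f\,d(\mu S(t))=\int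 S(t)f\,d\mu$ for all $f\in C(\Omega)$. If $\mu\neq\nu$ are probability measures on $\Omega$, then $\mu S(t)\neq\nu S(t)$ for all $t>0$. -/

import Mathlib

open MeasureTheory Filter Topology
open scoped NNReal

noncomputable section

namespace SpinFlip

/-! ### Markov semigroups on a compact space and their action on probability measures -/

/-- A Markov (Feller) semigroup on `C(X)`, `X` compact: a strongly continuous semigroup of positive
operators that fix the constant function `1` (hence contractions for the supremum norm). -/
structure MarkovSemigroup (X : Type*) [TopologicalSpace X] [CompactSpace X] where
  /-- the operator `S(t)` -/
  op : ℝ≥0 → C(X, ℝ) →L[ℝ] C(X, ℝ)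
  op_zero : op 0 = ContinuousLinearMap.id ℝ C(X, ℝ)
  op_add : ∀ s t, op (s + t) = (op s).comp (op t)
  op_one : ∀ t, op t 1 = 1
  op_nonneg : ∀ t f, 0 ≤ f → 0 ≤ op t f
  tendsto_zero : ∀ f, Tendsto (fun t => op t f) (𝓝[>] 0) (𝓝 f)

namespace MarkovSemigroup

section General

variable {X : Type*} [TopologicalSpace X] [CompactSpace X]

/-- The graph of the infinitesimal generator: all `(f, g)` with `(S(t) f - f) / t → g` uniformly
as `t ↓ 0`. -/
def generatorGraph (S : MarkovSemigroup X) : Set (C(X, ℝ) × C(X, ℝ)) :=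
  {p | Tendsto (fun t : ℝ≥0 => (t : ℝ)⁻¹ • (S.op t p.1 - p.1)) (𝓝[>] 0) (𝓝 p.2)}

/-- `S` is the semigroup generated by the closure (in the supremum norm) of the pre-generator `L`:
the infinitesimal generator of `S` is the closure of `L`. -/
def IsGeneratedByClosure (S : MarkovSemigroup X) (L : C(X, ℝ) →ₗ.[ℝ] C(X, ℝ)) : Prop :=
  S.generatorGraph = closure (L.graph : Set (C(X, ℝ) × C(X, ℝ)))

variable [T2Space X] [MeasurableSpace X] [BorelSpace X]

/-- The positive linear functional `f ↦ ∫ S(t) f dμ`. -/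
def functional (S : MarkovSemigroup X) (μ : ProbabilityMeasure X) (t : ℝ≥0) :
    CompactlySupportedContinuousMap X ℝ →ₚ[ℝ] ℝ :=
  PositiveLinearMap.mk₀
    { toFun := fun f => ∫ x, S.op t f.toContinuousMap x ∂(μ : Measure X)
      map_add' := fun f g => by
        have h : (f + g).toContinuousMap = f.toContinuousMap + g.toContinuousMap := rfl
        rw [h, map_add]
        exact integral_add
          ((S.op t f.toContinuousMap).continuous.integrable_of_hasCompactSupport
            (HasCompactSupport.of_compactSpace _))
          ((S.op t g.toContinuousMap).continuous.integrable_of_hasCompactSupport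
            (HasCompactSupport.of_compactSpace _))
      map_smul' := fun c f => by
        have h : (c • f).toContinuousMap = c • f.toContinuousMap := rfl
        rw [h, map_smul]
        exact integral_const_mul c _ }
    (fun f hf => integral_nonneg (fun x => S.op_nonneg t f.toContinuousMap hf x))

theorem integral_rieszMeasure_functional (S : MarkovSemigroup X) (μ : ProbabilityMeasure X)
    (t : ℝ≥0) (f : C(X, ℝ)) :
    ∫ x, f x ∂(RealRMK.rieszMeasure (S.functional μ t)) = ∫ x, S.op t f x ∂(μ : Measure X) :=
  RealRMK.integral_rieszMeasure (S.functional μ t)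
    (CompactlySupportedContinuousMap.continuousMapEquiv f)

theorem isProbabilityMeasure_rieszMeasure (S : MarkovSemigroup X) (μ : ProbabilityMeasure X)
    (t : ℝ≥0) : IsProbabilityMeasure (RealRMK.rieszMeasure (S.functional μ t)) := by
  have h := S.integral_rieszMeasure_functional μ t 1
  rw [S.op_one] at h
  simp only [ContinuousMap.one_apply, integral_const, smul_eq_mul, mul_one, probReal_univ] at h
  refine ⟨?_⟩
  rw [Measure.real, ENNReal.toReal_eq_one_iff] at h
  exact h

/-- The time-evolved measure `μ S(t)`: the measure that represents the positive functional
`f ↦ ∫ S(t) f dμ`. -/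
def evolve (S : MarkovSemigroup X) (μ : ProbabilityMeasure X) (t : ℝ≥0) : ProbabilityMeasure X :=
  ⟨RealRMK.rieszMeasure (S.functional μ t), S.isProbabilityMeasure_rieszMeasure μ t⟩

/-- The defining equation `∫ f d(μ S(t)) = ∫ S(t) f dμ`. -/
theorem integral_evolve (S : MarkovSemigroup X) (μ : ProbabilityMeasure X) (t : ℝ≥0)
    (f : C(X, ℝ)) :
    ∫ x, f x ∂(S.evolve μ t : Measure X) = ∫ x, S.op t f x ∂(μ : Measure X) :=
  S.integral_rieszMeasure_functional μ t f

end General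

end MarkovSemigroup

/-! ### Spin configurations and translation-invariant finite-range spin-flip generators -/

/-- The lattice `ℤ^d`. -/
abbrev Site (d : ℕ) : Type := Fin d → ℤ

/-- Ising configurations on `ℤ^d`; the group `ℤˣ` is `{-1, 1}`. The topology and the
`σ`-field are the product ones. -/
abbrev Config (d : ℕ) : Type := Site d → ℤˣ

instance instBorelSpaceSpin : BorelSpace ℤˣ where
  measurable_eq := by
    rw [borel_eq_top_of_discrete]
    refine top_le_iff.mp fun s _ => ?_
    exact ⟨Units.val '' s, trivial, Set.preimage_image_eq s Units.val_injective⟩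

variable {d : ℕ}

/-- The configuration `σ^i`, with the spin at `i` flipped. -/
def flip (i : Site d) (σ : Config d) : Config d := Function.update σ i (-σ i)

theorem continuous_flip (i : Site d) : Continuous (flip i) :=
  continuous_id.update i ((continuous_of_discreteTopology (f := fun s : ℤˣ => -s)).comp
    (continuous_apply i))

/-- The discrete gradient `∇_i f (σ) = f (σ^i) - f (σ)`. -/
def grad (i : Site d) (f : C(Config d, ℝ)) : C(Config d, ℝ) :=
  f.comp ⟨flip i, continuous_flip i⟩ - f

/-- The spin at `i` as a continuous real function. -/
def spin (i : Site d) : C(Config d, ℝ) where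
  toFun σ := ((σ i : ℤ) : ℝ)
  continuous_toFun := (continuous_of_discreteTopology (f := fun s : ℤˣ => ((s : ℤ) : ℝ))).comp
    (continuous_apply i)

/-- `σ_B = ∏_{i ∈ B} σ_i`, with `σ_∅ = 1`. -/
def spinProd (B : Finset (Site d)) : C(Config d, ℝ) := ∏ i ∈ B, spin i

/-- The translate `B + i`. -/
def translate (B : Finset (Site d)) (i : Site d) : Finset (Site d) :=
  B.map (addRightEmbedding i)

/-- The space of local functions: those depending on finitely many coordinates. -/
def localFunctions (d : ℕ) : Submodule ℝ C(Config d, ℝ) where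
  carrier := {f | ∃ A : Finset (Site d), DependsOn f (A : Set (Site d))}
  zero_mem' := ⟨∅, fun _ _ _ => rfl⟩
  add_mem' := by
    classical
    rintro f g ⟨A, hA⟩ ⟨A', hA'⟩
    refine ⟨A ∪ A', fun x y h => ?_⟩
    rw [ContinuousMap.add_apply, ContinuousMap.add_apply,
      hA fun i hi => h i (by simp_all), hA' fun i hi => h i (by simp_all)]
  smul_mem' := by
    rintro c f ⟨A, hA⟩
    refine ⟨A, fun x y h => ?_⟩
    rw [ContinuousMap.smul_apply, ContinuousMap.smul_apply, hA h]

theorem grad_eq_zero {f : C(Config d, ℝ)} {A : Finset (Site d)}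
    (hA : DependsOn f (A : Set (Site d))) {i : Site d} (hi : i ∉ A) : grad i f = 0 := by
  ext σ
  have h : f (flip i σ) = f σ := hA fun j hj => by
    have hji : j ≠ i := fun h => hi (h ▸ hj)
    simp [flip, hji]
  change f (flip i σ) - f σ = 0
  rw [h, sub_self]

theorem finite_support_buildingBlock (B : Finset (Site d)) {f : C(Config d, ℝ)}
    (hf : f ∈ localFunctions d) :
    (Function.support fun i => spinProd (translate B i) * grad i f).Finite := by
  obtain ⟨A, hA⟩ := hf
  refine A.finite_toSet.subset fun i hi => ?_
  by_contra hiA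
  exact hi (by simp [grad_eq_zero hA hiA])

/-- The building block `L_B = ∑_{i ∈ ℤ^d} σ_{B+i} ∇_i` on local functions (where only finitely many
terms of the sum are nonzero). -/
def buildingBlock (B : Finset (Site d)) : localFunctions d →ₗ[ℝ] C(Config d, ℝ) where
  toFun f := ∑ᶠ i : Site d, spinProd (translate B i) * grad i (f : C(Config d, ℝ))
  map_add' f g := by
    rw [← finsum_add_distrib (finite_support_buildingBlock B f.2)
      (finite_support_buildingBlock B g.2)]
    refine finsum_congr fun i => ?_
    ext σ
    simp only [grad, Submodule.coe_add, ContinuousMap.mul_apply, ContinuousMap.sub_apply,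
      ContinuousMap.comp_apply, ContinuousMap.add_apply]
    ring
  map_smul' c f := by
    rw [RingHom.id_apply, smul_finsum' c (finite_support_buildingBlock B f.2)]
    refine finsum_congr fun i => ?_
    ext σ
    simp only [grad, Submodule.coe_smul, ContinuousMap.mul_apply, ContinuousMap.sub_apply,
      ContinuousMap.comp_apply, ContinuousMap.smul_apply, smul_eq_mul]
    ring

/-- The flip rate `c(i, σ) = ∑_{B ∈ 𝓑} λ(B) σ_{B+i}` of the generator `∑_{B ∈ 𝓑} λ(B) L_B`. -/
def flipRate (𝓑 : Finset (Finset (Site d))) (lam : Finset (Site d) → ℝ) (i : Site d)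
    (σ : Config d) : ℝ :=
  ∑ B ∈ 𝓑, lam B * spinProd (translate B i) σ

/-- The translation-invariant finite-range pre-generator `∑_{B ∈ 𝓑} λ(B) L_B`, with domain the
local functions. -/
def preGenerator (𝓑 : Finset (Finset (Site d))) (lam : Finset (Site d) → ℝ) :
    C(Config d, ℝ) →ₗ.[ℝ] C(Config d, ℝ) where
  domain := localFunctions d
  toFun := ∑ B ∈ 𝓑, lam B • buildingBlock B

end SpinFlip

end

open scoped symmDiff

/-! ### Markov semigroups: contraction, Taylor expansion along the generator, dense range and
injectivity -/

namespace SpinFlip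

namespace MarkovSemigroup

section Analysis

variable {X : Type*} [TopologicalSpace X] [CompactSpace X] (S : MarkovSemigroup X)

/-! If `S(t)` has dense range, then `μ ↦ μS(t)` is injective, since integrals over the range
determine a measure (`evolve_injective`). For small `t`, dense range follows by running the dynamics
backwards on monomials: with `L` the generator, the partial sums of `∑ (-t)^n/n! L^n σ_A` are
approximate preimages of `σ_A`, by a Taylor estimate (`norm_op_taylor_sub_le`). The remainder
vanishes because `L` sends `σ_A` to a combination of at most `|𝓑||A|` monomials whose degree has
grown by at most `b = max |B|`, so that `‖L^n σ_A‖` grows like `K^n n!` up to a polynomial factor in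
`n`, with `K` independent of `A` (`norm_localGenerator_pow_localSpinProd_le`). Hence one time step
serves all monomials, which span a dense subspace, and `S(t) = S(t/n)^n` reaches every `t`. -/

theorem norm_op_apply_le (t : ℝ≥0) (f : C(X, ℝ)) : ‖S.op t f‖ ≤ ‖f‖ := by
  have h1 : 0 ≤ S.op t (‖f‖ • 1 - f) := S.op_nonneg t _ fun x => by
    have := (abs_le.mp (f.norm_coe_le_norm x)).2
    change 0 ≤ ‖f‖ * 1 - f x
    linarith
  have h2 : 0 ≤ S.op t (‖f‖ • 1 + f) := S.op_nonneg t _ fun x => by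
    have := (abs_le.mp (f.norm_coe_le_norm x)).1
    change 0 ≤ ‖f‖ * 1 + f x
    linarith
  rw [map_sub, map_smul, S.op_one] at h1
  rw [map_add, map_smul, S.op_one] at h2
  refine (ContinuousMap.norm_le _ (norm_nonneg f)).mpr fun x => abs_le.mpr ⟨?_, ?_⟩
  · have : 0 ≤ ‖f‖ * 1 + S.op t f x := h2 x
    linarith
  · have : 0 ≤ ‖f‖ * 1 - S.op t f x := h1 x
    linarith

theorem norm_op_sub_op_le_of_le {s t : ℝ≥0} (h : s ≤ t) (f : C(X, ℝ)) :
    ‖S.op t f - S.op s f‖ ≤ ‖S.op (t - s) f - f‖ := by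
  have : S.op t f - S.op s f = S.op s (S.op (t - s) f - f) := by
    conv_lhs => rw [← add_tsub_cancel_of_le h, S.op_add]
    simp
  rw [this]
  exact S.norm_op_apply_le _ _

theorem norm_op_sub_op_le (s t : ℝ≥0) (f : C(X, ℝ)) :
    ‖S.op t f - S.op s f‖ ≤ ‖S.op (nndist t s) f - f‖ := by
  rcases le_total s t with h | h
  · rw [NNReal.nndist_eq, tsub_eq_zero_of_le h, max_eq_left (zero_le)]
    exact S.norm_op_sub_op_le_of_le h f
  · rw [NNReal.nndist_eq, tsub_eq_zero_of_le h, max_eq_right (zero_le), norm_sub_rev]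
    exact S.norm_op_sub_op_le_of_le h f

theorem continuous_op_apply (f : C(X, ℝ)) : Continuous fun t => S.op t f := by
  have h0 : Tendsto (fun t => S.op t f) (𝓝 0) (𝓝 f) := by
    have h : Tendsto (fun t => S.op t f) (𝓝[≥] 0) (𝓝 f) := by
      rw [← Set.Ioi_insert, nhdsWithin_insert, tendsto_sup]
      refine ⟨?_, S.tendsto_zero f⟩
      have := tendsto_pure_nhds (fun t => S.op t f) 0
      simpa [S.op_zero] using this
    have huniv : Set.Ici (0 : ℝ≥0) = Set.univ := Set.eq_univ_of_forall fun t => zero_le (a := t)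
    rwa [huniv, nhdsWithin_univ] at h
  rw [continuous_iff_continuousAt]
  intro s
  rw [ContinuousAt, tendsto_iff_norm_sub_tendsto_zero]
  refine squeeze_zero (fun _ => norm_nonneg _) (fun t => S.norm_op_sub_op_le s t f) ?_
  have hd : Tendsto (fun t => nndist t s) (𝓝 s) (𝓝 0) := by
    have : Continuous fun t => nndist t s := continuous_id.nndist continuous_const
    simpa using this.tendsto s
  exact tendsto_iff_norm_sub_tendsto_zero.mp (h0.comp hd)

/-- Only the right derivative comes directly from the generator; it suffices for the mean value
inequality used below. -/
theorem hasDerivWithinAt_op_apply {f g : C(X, ℝ)} (hfg : (f, g) ∈ S.generatorGraph) {x : ℝ}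
    (hx : 0 ≤ x) :
    HasDerivWithinAt (fun y : ℝ => S.op y.toNNReal f) (S.op x.toNNReal g) (Set.Ici x) x := by
  rw [← hasDerivWithinAt_Ioi_iff_Ici,
    hasDerivWithinAt_iff_tendsto_slope' (Set.notMem_Ioi.mpr le_rfl)]
  have hlim : Tendsto (fun y : ℝ => (y - x).toNNReal) (𝓝[>] x) (𝓝[>] 0) := by
    refine tendsto_nhdsWithin_iff.mpr ⟨?_, ?_⟩
    · have : Continuous fun y : ℝ => (y - x).toNNReal := by fun_prop
      simpa using (this.tendsto x).mono_left nhdsWithin_le_nhds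
    · filter_upwards [self_mem_nhdsWithin] with y hy
      simpa using hy
  have h := ((S.op x.toNNReal).continuous.tendsto g).comp (Tendsto.comp hfg hlim)
  refine h.congr' ?_
  filter_upwards [self_mem_nhdsWithin] with y hy
  have hxy : x < y := hy
  have hadd : y.toNNReal = x.toNNReal + (y - x).toNNReal := by
    rw [← Real.toNNReal_add hx (sub_nonneg.mpr hxy.le)]
    congr 1
    ring
  simp only [Function.comp_apply, slope_def_module, map_smul, map_sub]
  rw [Real.coe_toNNReal _ (sub_nonneg.mpr hxy.le), hadd, S.op_add]
  simp

/-- The product rule telescopes: differentiating the weight of term `N + 1` cancels the derivative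
left over from the terms up to `N`. -/
theorem hasDerivWithinAt_op_taylor {h : ℕ → C(X, ℝ)}
    (hh : ∀ n, (h n, h (n + 1)) ∈ S.generatorGraph) (N : ℕ) {x : ℝ} (hx : 0 ≤ x) :
    HasDerivWithinAt
      (fun y : ℝ => ∑ n ∈ Finset.range (N + 1), ((-y) ^ n / n.factorial) • S.op y.toNNReal (h n))
      (((-x) ^ N / N.factorial) • S.op x.toNNReal (h (N + 1))) (Set.Ici x) x := by
  induction N with
  | zero => simpa using S.hasDerivWithinAt_op_apply (hh 0) hx
  | succ N ih =>
    simp_rw [Finset.sum_range_succ _ (N + 1)]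
    have hc : HasDerivWithinAt (fun y : ℝ => (-y) ^ (N + 1) / (N + 1).factorial)
        (-((-x) ^ N / N.factorial)) (Set.Ici x) x := by
      have := (((hasDerivAt_id x).neg.pow (N + 1)).div_const
        ((N + 1).factorial : ℝ)).hasDerivWithinAt (s := Set.Ici x)
      refine this.congr_deriv ?_
      rw [Nat.factorial_succ]
      push_cast
      simp only [Pi.neg_apply, id]
      field_simp
    refine (ih.add (hc.smul (S.hasDerivWithinAt_op_apply (hh (N + 1)) hx))).congr_deriv ?_
    module

/-- Mean value inequality on `[0, t]` for the telescoped sum, whose value at `0` is `h 0`. Bounding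
the derivative by its supremum costs a harmless factor `N + 1` against the sharp remainder. -/
theorem norm_op_taylor_sub_le {h : ℕ → C(X, ℝ)}
    (hh : ∀ n, (h n, h (n + 1)) ∈ S.generatorGraph) (N : ℕ) (t : ℝ≥0) :
    ‖S.op t (∑ n ∈ Finset.range (N + 1), ((-t : ℝ) ^ n / n.factorial) • h n) - h 0‖ ≤
      (t : ℝ) ^ (N + 1) / N.factorial * ‖h (N + 1)‖ := by
  have key := norm_image_sub_le_of_norm_deriv_right_le_segment (a := (0 : ℝ)) (b := (t : ℝ))
    (f := fun y : ℝ => ∑ n ∈ Finset.range (N + 1),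
      ((-y) ^ n / n.factorial) • S.op y.toNNReal (h n))
    (C := (t : ℝ) ^ N / N.factorial * ‖h (N + 1)‖)
    (Continuous.continuousOn <| continuous_finsetSum _ fun n _ =>
      ((continuous_neg.pow n).div_const _).smul
        ((S.continuous_op_apply (h n)).comp continuous_real_toNNReal))
    (fun x hx => S.hasDerivWithinAt_op_taylor hh N hx.1)
    (fun x hx => by
      rw [norm_smul, norm_div, norm_pow, norm_neg, Real.norm_of_nonneg hx.1, RCLike.norm_natCast]
      gcongr
      · exact hx.1
      · exact hx.2.le
      · exact S.norm_op_apply_le _ _)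
    t ⟨t.2, le_rfl⟩
  have h0 : ∑ n ∈ Finset.range (N + 1),
      ((-(0 : ℝ)) ^ n / n.factorial) • S.op (0 : ℝ).toNNReal (h n) = h 0 := by
    rw [Finset.sum_eq_single 0]
    · simp [S.op_zero]
    · intro n _ hn
      simp [hn]
    · simp
  simp only [h0, Real.toNNReal_coe, sub_zero] at key
  rw [map_sum]
  simp only [map_smul]
  exact key.trans (le_of_eq (by ring))

theorem denseRange_op_nsmul {t : ℝ≥0} (h : DenseRange (S.op t)) (n : ℕ) :
    DenseRange (S.op (n • t)) := by
  induction n with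
  | zero =>
    rw [zero_smul, S.op_zero]
    exact Function.surjective_id.denseRange
  | succ n ih =>
    rw [succ_nsmul, S.op_add]
    exact ih.comp h (S.op (n • t)).continuous

variable [T2Space X] [MeasurableSpace X] [BorelSpace X] [HasOuterApproxClosed X]

theorem evolve_injective {t : ℝ≥0} (h : DenseRange (S.op t)) :
    Function.Injective fun μ => S.evolve μ t := by
  intro μ ν hμν
  have hint (ρ : ProbabilityMeasure X) : Continuous fun f : C(X, ℝ) =>
      ∫ x, f x ∂(ρ : Measure X) := by
    refine LipschitzWith.continuous (K := 1) (LipschitzWith.of_dist_le_mul fun f g => ?_)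
    rw [dist_eq_norm, dist_eq_norm, ← integral_sub
      (f.continuous.integrable_of_hasCompactSupport (HasCompactSupport.of_compactSpace _))
      (g.continuous.integrable_of_hasCompactSupport (HasCompactSupport.of_compactSpace _))]
    refine (norm_integral_le_of_norm_le_const (C := ‖f - g‖)
      (Eventually.of_forall fun x => (f - g).norm_coe_le_norm x)).trans ?_
    simp
  have heq : (fun f : C(X, ℝ) => ∫ x, f x ∂(μ : Measure X)) =
      fun f => ∫ x, f x ∂(ν : Measure X) := by
    refine h.equalizer (hint μ) (hint ν) (funext fun f => ?_)
    simp only [Function.comp_apply, ← integral_evolve]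
    exact congrArg (fun ρ : ProbabilityMeasure X => ∫ x, f x ∂(ρ : Measure X)) hμν
  have hm : (μ : Measure X) = ν :=
    ext_of_forall_integral_eq_of_IsFiniteMeasure fun f => congrFun heq f.toContinuousMap
  exact Subtype.ext hm

end Analysis

end MarkovSemigroup

end SpinFlip

namespace SpinFlip

variable {d : ℕ}

/-! ### Spin monomials: action of the generator, growth of its powers, density -/

section Spins

theorem spin_mul_self (i : Site d) : spin i * spin i = 1 := by
  ext σ
  change ((σ i : ℤ) : ℝ) * ((σ i : ℤ) : ℝ) = 1
  rw [← Int.cast_mul, ← Units.val_mul, Int.units_mul_self]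
  simp

theorem norm_spinProd_le_one (A : Finset (Site d)) : ‖spinProd A‖ ≤ 1 := by
  refine (ContinuousMap.norm_le _ zero_le_one).mpr fun σ => ?_
  rw [spinProd, ContinuousMap.prod_apply, norm_prod]
  refine Finset.prod_le_one (fun _ _ => norm_nonneg _) fun i _ => ?_
  change ‖((σ i : ℤ) : ℝ)‖ ≤ 1
  rcases Int.units_eq_one_or (σ i) with h | h <;> simp [h]

/-- Spins square to `1`, so the sites of `A ∩ B` drop out. -/
theorem spinProd_mul_spinProd (A B : Finset (Site d)) :
    spinProd A * spinProd B = spinProd (A ∆ B) := by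
  have hA : A = (A \ B) ∪ (A ∩ B) := (Finset.sdiff_union_inter A B).symm
  have hB : B = (B \ A) ∪ (A ∩ B) := by
    rw [Finset.inter_comm]
    exact (Finset.sdiff_union_inter B A).symm
  have h1 : spinProd A = spinProd (A \ B) * spinProd (A ∩ B) := by
    conv_lhs => rw [hA]
    exact Finset.prod_union (Finset.disjoint_sdiff_inter A B)
  have h2 : spinProd B = spinProd (B \ A) * spinProd (A ∩ B) := by
    conv_lhs => rw [hB]
    refine Finset.prod_union ?_
    rw [Finset.inter_comm]
    exact Finset.disjoint_sdiff_inter B A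
  have h3 : spinProd (A ∆ B) = spinProd (A \ B) * spinProd (B \ A) :=
    Finset.prod_union disjoint_sdiff_sdiff
  have h4 : spinProd (A ∩ B) * spinProd (A ∩ B) = 1 := by
    rw [spinProd, ← Finset.prod_mul_distrib]
    exact Finset.prod_eq_one fun i _ => spin_mul_self i
  rw [h1, h2, h3, mul_mul_mul_comm, h4, mul_one]

theorem spinProd_mem_localFunctions (A : Finset (Site d)) : spinProd A ∈ localFunctions d := by
  refine ⟨A, fun σ τ h => ?_⟩
  rw [spinProd, ContinuousMap.prod_apply, ContinuousMap.prod_apply]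
  refine Finset.prod_congr rfl fun i hi => ?_
  change ((σ i : ℤ) : ℝ) = ((τ i : ℤ) : ℝ)
  rw [h i hi]

theorem mul_mem_localFunctions {f g : C(Config d, ℝ)} (hf : f ∈ localFunctions d)
    (hg : g ∈ localFunctions d) : f * g ∈ localFunctions d := by
  classical
  obtain ⟨A, hA⟩ := hf
  obtain ⟨B, hB⟩ := hg
  refine ⟨A ∪ B, fun σ τ h => ?_⟩
  rw [ContinuousMap.mul_apply, ContinuousMap.mul_apply,
    hA fun i hi => h i (by simp_all), hB fun i hi => h i (by simp_all)]

theorem grad_mem_localFunctions (i : Site d) {f : C(Config d, ℝ)} (hf : f ∈ localFunctions d) :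
    grad i f ∈ localFunctions d := by
  obtain ⟨A, hA⟩ := hf
  refine ⟨A, fun σ τ h => ?_⟩
  change f (flip i σ) - f σ = f (flip i τ) - f τ
  rw [hA h, hA fun j hj => ?_]
  by_cases hji : j = i
  · subst hji
    simp [flip, h j hj]
  · simp [flip, hji, h j hj]

theorem grad_spinProd {i : Site d} {A : Finset (Site d)} (hi : i ∈ A) :
    grad i (spinProd A) = (-2 : ℝ) • spinProd A := by
  ext σ
  change spinProd A (flip i σ) - spinProd A σ = -2 * spinProd A σ
  have h : spinProd A (flip i σ) = -spinProd A σ := by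
    rw [spinProd, ContinuousMap.prod_apply, ContinuousMap.prod_apply,
      ← Finset.mul_prod_erase _ _ hi, ← Finset.mul_prod_erase A (fun j => spin j σ) hi,
      ← neg_mul]
    congr 1
    · change (((flip i σ) i : ℤ) : ℝ) = -((σ i : ℤ) : ℝ)
      simp [flip]
    · refine Finset.prod_congr rfl fun j hj => ?_
      change (((flip i σ) j : ℤ) : ℝ) = ((σ j : ℤ) : ℝ)
      simp [flip, Finset.ne_of_mem_erase hj]
  rw [h]
  ring

theorem buildingBlock_mem_localFunctions (B : Finset (Site d)) (f : localFunctions d) :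
    buildingBlock B f ∈ localFunctions d := by
  change ∑ᶠ i : Site d, spinProd (translate B i) * grad i (f : C(Config d, ℝ)) ∈ _
  exact finsum_induction (· ∈ localFunctions d) (zero_mem _) (fun _ _ => add_mem) fun i =>
    mul_mem_localFunctions (spinProd_mem_localFunctions _) (grad_mem_localFunctions i f.2)

/-- The monomial `σ_A` as a local function. -/
noncomputable def localSpinProd (A : Finset (Site d)) : localFunctions d :=
  ⟨spinProd A, spinProd_mem_localFunctions A⟩

/-- The pre-generator as an endomorphism of the space of local functions. -/
noncomputable def localGenerator (𝓑 : Finset (Finset (Site d))) (lam : Finset (Site d) → ℝ) :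
    Module.End ℝ (localFunctions d) :=
  ∑ B ∈ 𝓑, lam B • (buildingBlock B).codRestrict (localFunctions d)
    (buildingBlock_mem_localFunctions B)

theorem mem_graph_preGenerator (𝓑 : Finset (Finset (Site d))) (lam : Finset (Site d) → ℝ)
    (f : localFunctions d) :
    ((f : C(Config d, ℝ)), (localGenerator 𝓑 lam f : C(Config d, ℝ))) ∈
      (preGenerator 𝓑 lam).graph := by
  rw [LinearPMap.mem_graph_iff]
  refine ⟨f, rfl, ?_⟩
  change (∑ B ∈ 𝓑, lam B • buildingBlock B) f = _
  simp [localGenerator, LinearMap.sum_apply]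

theorem localGenerator_localSpinProd (𝓑 : Finset (Finset (Site d)))
    (lam : Finset (Site d) → ℝ) (A : Finset (Site d)) :
    localGenerator 𝓑 lam (localSpinProd A) =
      ∑ B ∈ 𝓑, ∑ i ∈ A, (-2 * lam B) • localSpinProd (translate B i ∆ A) := by
  rw [localGenerator, LinearMap.sum_apply]
  refine Finset.sum_congr rfl fun B _ => Subtype.ext ?_
  rw [LinearMap.smul_apply, Submodule.coe_smul, LinearMap.codRestrict_apply]
  change lam B • ∑ᶠ i : Site d, spinProd (translate B i) * grad i (spinProd A) = _
  rw [finsum_eq_sum_of_support_subset (s := A)]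
  · simp only [Submodule.coe_sum, Submodule.coe_smul, Finset.smul_sum]
    refine Finset.sum_congr rfl fun i hi => ?_
    rw [grad_spinProd hi, mul_smul_comm, spinProd_mul_spinProd, smul_smul, mul_comm]
    rfl
  · intro i hi
    by_contra hiA
    refine hi ?_
    have hdep : DependsOn (spinProd A) (A : Set (Site d)) := fun σ τ h => by
      rw [spinProd, ContinuousMap.prod_apply, ContinuousMap.prod_apply]
      refine Finset.prod_congr rfl fun i hi => ?_
      change ((σ i : ℤ) : ℝ) = ((τ i : ℤ) : ℝ)
      rw [h i hi]
    simp [grad_eq_zero hdep hiA]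

/-- Each application produces at most `|A| ≤ b m` terms per `B`, of weight `2|λ(B)|`, and raises the
degree bound from `b m` to `b (m + 1)`. Measuring degree in units of `b` makes the accumulated
factors `m (m + 1) ⋯ (m + n - 1)`. -/
theorem norm_localGenerator_pow_localSpinProd_le (𝓑 : Finset (Finset (Site d)))
    (lam : Finset (Site d) → ℝ) {b : ℕ} (hb : ∀ B ∈ 𝓑, B.card ≤ b) (n : ℕ) :
    ∀ (m : ℕ) (A : Finset (Site d)), A.card ≤ b * m →
      ‖(localGenerator 𝓑 lam ^ n) (localSpinProd A)‖ ≤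
        (2 * (∑ B ∈ 𝓑, |lam B|) * b) ^ n * m.ascFactorial n := by
  have hK : 0 ≤ 2 * (∑ B ∈ 𝓑, |lam B|) * b := by positivity
  induction n with
  | zero =>
    intro m A _
    simpa [localSpinProd] using norm_spinProd_le_one A
  | succ n ih =>
    intro m A hA
    set K := 2 * (∑ B ∈ 𝓑, |lam B|) * b with hKdef
    -- The innermost factor is peeled off, so the induction hypothesis is applied to the new
    -- monomials with `m + 1`.
    rw [pow_succ, Module.End.mul_apply, localGenerator_localSpinProd, map_sum]
    simp only [map_sum, map_smul]
    calc ‖∑ B ∈ 𝓑, ∑ i ∈ A, (-2 * lam B) •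
            (localGenerator 𝓑 lam ^ n) (localSpinProd (translate B i ∆ A))‖
        ≤ ∑ B ∈ 𝓑, ∑ i ∈ A, 2 * |lam B| * (K ^ n * (m + 1).ascFactorial n) := by
          refine norm_sum_le_of_le _ fun B hB => norm_sum_le_of_le _ fun i _ => ?_
          change ‖(-2 * lam B) • ((localGenerator 𝓑 lam ^ n)
            (localSpinProd (translate B i ∆ A)) : C(Config d, ℝ))‖ ≤ _
          rw [norm_smul, norm_mul, norm_neg, Real.norm_ofNat, Real.norm_eq_abs]
          refine mul_le_mul_of_nonneg_left (ih _ _ ?_) (by positivity)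
          calc (translate B i ∆ A).card ≤ (translate B i ∪ A).card :=
                Finset.card_le_card symmDiff_le_sup
            _ ≤ (translate B i).card + A.card := Finset.card_union_le _ _
            _ ≤ b + b * m := by
                refine add_le_add ?_ hA
                rw [translate, Finset.card_map]
                exact hb B hB
            _ = b * (m + 1) := by ring
      _ = 2 * (∑ B ∈ 𝓑, |lam B|) * A.card * (K ^ n * (m + 1).ascFactorial n) := by
          simp only [Finset.sum_const, nsmul_eq_mul, Finset.mul_sum, Finset.sum_mul]
          refine Finset.sum_congr rfl fun B _ => ?_
          ring
      _ ≤ 2 * (∑ B ∈ 𝓑, |lam B|) * (b * m) * (K ^ n * (m + 1).ascFactorial n) := by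
          gcongr
          exact_mod_cast hA
      _ = K ^ (n + 1) * m.ascFactorial (n + 1) := by
          have h : (m : ℝ) * (m + 1).ascFactorial n = m.ascFactorial (n + 1) := by
            rw [Nat.ascFactorial_succ, ← Nat.succ_ascFactorial]
            push_cast
            rfl
          rw [← h, pow_succ, hKdef]
          ring

/-- Stone–Weierstrass: monomials are closed under products, so their span contains the algebra
generated by the spins, which separates points. -/
theorem dense_span_range_spinProd :
    Dense (Submodule.span ℝ (Set.range (spinProd (d := d))) : Set C(Config d, ℝ)) := by
  have hsep : (Algebra.adjoin ℝ (Set.range (spin (d := d)))).SeparatesPoints := by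
    intro σ τ hne
    obtain ⟨i, hi⟩ := Function.ne_iff.mp hne
    refine ⟨spin i, ⟨spin i, Algebra.subset_adjoin ⟨i, rfl⟩, rfl⟩, fun h => hi ?_⟩
    have h' : ((σ i : ℤ) : ℝ) = ((τ i : ℤ) : ℝ) := h
    exact Units.ext (by exact_mod_cast h')
  have htop := ContinuousMap.subalgebra_topologicalClosure_eq_top_of_separatesPoints _ hsep
  have hle : (Algebra.adjoin ℝ (Set.range (spin (d := d))) : Set C(Config d, ℝ)) ⊆
      Submodule.span ℝ (Set.range (spinProd (d := d))) := by
    intro f hf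
    rw [SetLike.mem_coe, ← Subalgebra.mem_toSubmodule, Algebra.adjoin_eq_span] at hf
    refine Submodule.span_mono (fun g hg => ?_) hf
    induction hg using Submonoid.closure_induction with
    | mem g hg =>
      obtain ⟨i, rfl⟩ := hg
      exact ⟨{i}, Finset.prod_singleton _ _⟩
    | one => exact ⟨∅, Finset.prod_empty⟩
    | mul f g _ _ hf hg =>
      obtain ⟨A, rfl⟩ := hf
      obtain ⟨B, rfl⟩ := hg
      exact ⟨A ∆ B, (spinProd_mul_spinProd A B).symm⟩
  refine Dense.mono hle (dense_iff_closure_eq.mpr ?_)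
  rw [← Subalgebra.topologicalClosure_coe, htop]
  rfl

end Spins

end SpinFlip

namespace SpinFlip

variable {d : ℕ}

/-! ### Dense range of the spin-flip semigroup -/

section DenseRange

variable {𝓑 : Finset (Finset (Site d))} {lam : Finset (Site d) → ℝ}
  {S : MarkovSemigroup (Config d)}

/-- The factorials combine to `(N + 1) x^(N + 1)` times a binomial coefficient; bounding the latter
by `2^(m + N + 1)` is crude and explains the condition `2 * x < 1`. -/
theorem tendsto_taylor_remainder {x : ℝ} (hx : 0 ≤ x) (hx1 : 2 * x < 1) (m : ℕ) :
    Tendsto (fun N : ℕ => x ^ (N + 1) / N.factorial * (m + 1).ascFactorial (N + 1))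
      atTop (𝓝 0) := by
  have h := ((tendsto_self_mul_const_pow_of_lt_one (by positivity : 0 ≤ 2 * x) hx1).comp
    (tendsto_add_atTop_nat 1)).const_mul ((2 : ℝ) ^ m)
  rw [mul_zero] at h
  refine squeeze_zero (fun N => by positivity) (fun N => ?_) h
  have hchoose : (((m + (N + 1)).choose (N + 1) : ℕ) : ℝ) ≤ 2 ^ (m + (N + 1)) := by
    exact_mod_cast Nat.choose_le_two_pow _ _
  calc x ^ (N + 1) / N.factorial * (m + 1).ascFactorial (N + 1)
      = (N + 1) * x ^ (N + 1) * (m + (N + 1)).choose (N + 1) := by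
        rw [Nat.ascFactorial_eq_factorial_mul_choose, Nat.factorial_succ]
        push_cast
        field_simp
    _ ≤ (N + 1) * x ^ (N + 1) * 2 ^ (m + (N + 1)) := by gcongr
    _ = 2 ^ m * (((N + 1 : ℕ) : ℝ) * (2 * x) ^ (N + 1)) := by
        rw [pow_add, mul_pow]
        push_cast
        ring

theorem spinProd_mem_closure_range_op (hS : S.IsGeneratedByClosure (preGenerator 𝓑 lam))
    {b : ℕ} (hb1 : 1 ≤ b) (hb : ∀ B ∈ 𝓑, B.card ≤ b) {t : ℝ≥0}
    (ht : 2 * (t * (2 * (∑ B ∈ 𝓑, |lam B|) * b)) < 1) (A : Finset (Site d)) :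
    spinProd A ∈ closure (Set.range (S.op t)) := by
  have hgen (n : ℕ) : (((localGenerator 𝓑 lam ^ n) (localSpinProd A) : C(Config d, ℝ)),
      ((localGenerator 𝓑 lam ^ (n + 1)) (localSpinProd A) : C(Config d, ℝ))) ∈
        S.generatorGraph := by
    rw [hS, pow_succ', Module.End.mul_apply]
    exact subset_closure (mem_graph_preGenerator 𝓑 lam _)
  -- The growth bound is used with `m = |A| + 1`; this needs `b ≥ 1`.
  have hA : A.card ≤ b * (A.card + 1) := by nlinarith
  refine mem_closure_of_tendsto (b := atTop) (tendsto_iff_norm_sub_tendsto_zero.mpr <|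
    squeeze_zero (fun _ => norm_nonneg _) (fun N => ?_)
      (tendsto_taylor_remainder (by positivity) ht A.card))
    (Eventually.of_forall fun N => Set.mem_range_self (∑ n ∈ Finset.range (N + 1),
      ((-t : ℝ) ^ n / n.factorial) •
        ((localGenerator 𝓑 lam ^ n) (localSpinProd A) : C(Config d, ℝ))))
  refine (S.norm_op_taylor_sub_le hgen N t).trans ?_
  rw [mul_pow, mul_div_right_comm, mul_assoc]
  exact mul_le_mul_of_nonneg_left
    (norm_localGenerator_pow_localSpinProd_le 𝓑 lam hb (N + 1) _ A hA) (by positivity)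

theorem denseRange_op (hS : S.IsGeneratedByClosure (preGenerator 𝓑 lam)) (t : ℝ≥0) :
    DenseRange (S.op t) := by
  obtain ⟨b, hb1, hb⟩ : ∃ b : ℕ, 1 ≤ b ∧ ∀ B ∈ 𝓑, B.card ≤ b :=
    ⟨1 + 𝓑.sup Finset.card, Nat.le_add_right 1 _,
      fun _ hB => (Finset.le_sup hB).trans (Nat.le_add_left _ 1)⟩
  obtain ⟨K, hK0, hK⟩ : ∃ K : ℝ, 0 ≤ K ∧ 2 * (∑ B ∈ 𝓑, |lam B|) * b = K :=
    ⟨_, by positivity, rfl⟩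
  -- The admissible step does not depend on `A`, so one `n` makes `t / n` short enough for every
  -- monomial.
  obtain ⟨n, hn⟩ := exists_nat_gt (2 * (t * K))
  have hn0 : (0 : ℝ) < n := lt_of_le_of_lt (by positivity) hn
  have hsmall : 2 * (((t / n : ℝ≥0) : ℝ) * K) < 1 := by
    rw [NNReal.coe_div, NNReal.coe_natCast, div_mul_eq_mul_div, ← mul_div_assoc, div_lt_one hn0]
    exact hn
  have hdense : DenseRange (S.op (t / n)) := by
    have hle : Submodule.span ℝ (Set.range (spinProd (d := d))) ≤
        (LinearMap.range (S.op (t / n)).toLinearMap).topologicalClosure := by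
      refine Submodule.span_le.mpr ?_
      rintro _ ⟨A, rfl⟩
      exact spinProd_mem_closure_range_op hS hb1 hb (hK ▸ hsmall) A
    exact dense_closure.mp (Dense.mono hle dense_span_range_spinProd)
  have h := S.denseRange_op_nsmul hdense n
  rwa [nsmul_eq_mul, mul_div_cancel₀ _ (by exact_mod_cast hn0.ne')] at h

end DenseRange

end SpinFlip

theorem mainTheorem3 (d : ℕ)
    (𝓑 : Finset (Finset (SpinFlip.Site d))) (lam : Finset (SpinFlip.Site d) → ℝ)
    (hrate : ∀ (i : SpinFlip.Site d) (σ : SpinFlip.Config d), 0 ≤ SpinFlip.flipRate 𝓑 lam i σ)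
    (S : SpinFlip.MarkovSemigroup (SpinFlip.Config d))
    (hS : S.IsGeneratedByClosure (SpinFlip.preGenerator 𝓑 lam))
    (μ ν : ProbabilityMeasure (SpinFlip.Config d)) (hμν : μ ≠ ν)
    (t : ℝ≥0) (ht : 0 < t) :
    S.evolve μ t ≠ S.evolve ν t :=
  (S.evolve_injective (SpinFlip.denseRange_op hS t)).ne hμν
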